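/- Let $X,Y,Z$ be real locally convex topological vector spaces with topological duals $X^*,Y^*,Z^*$. For a set-valued mapping $F\colon X\rightrightarrows Y$ put $\operatorname{gph}F=\{(x,y): y\in F(x)\}$; $F$ is *convex* if $\operatorname{gph}F$ is convex, and *polyhedral* if $\operatorname{gph}F$ is a polyhedral set in $X\times Y$, where a subset $P$ of a topological vector space $W$ is *polyhedral* if $P=\{w\in W: \langle w_i^*,w\rangle\le\alpha_i,\ i=1,\dots,k\}$ for finitely many $w_i^*\in W^*$ and $\alpha_i\in\mathbb R$. For a convex set $\Omega\subset W$ let $$\operatorname{qri}(\Omega)=\{w\in\Omega:\ \overline{\operatorname{cone}(\Omega-w)}\text{ is a linear subspace of }W\},\qquad \operatorname{cone}(A)=\{ta: t\ge 0,\ a\in A\},$$ and let $N(\bar w;\Omega)=\{w^*\in W^*: \langle w^*,w-\bar w\rangle\le 0\ \text{for all } w\in\Omega\}$ if $\bar w\in\Omega$, and $N(\bar w;\Omega)=\emptyset$ otherwise. The *coderivative* of $F$ at $(\bar x,\bar y)\in\operatorname{gph}F$ is the set-valued mapping $D^*F(\bar x,\bar y)\colon Y^*\rightrightarrows X^*$,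 $$D^*F(\bar x,\bar y)(y^*)=\{x^*\in X^*: (x^*,-y^*)\in N((\bar x,\bar y);\operatorname{gph}F)\},$$ where $(x^*,-y^*)$ denotes the functional $(x,y)\mapsto\langle x^*,x\rangle-\langle y^*,y\rangle$. The composition of set-valued mappings is $(G\circ F)(x)=\bigcup_{y\in F(x)}G(y)$, and $G^{-1}(z)=\{y: z\in G(y)\}$. **Theorem.** Let $F\colon X\rightrightarrows Y$ and $G\colon Y\rightrightarrows Z$ be convex set-valued mappings. Suppose that one of the following two conditions holds: (a) $F$ is polyhedral and there exists $(\hat x,\hat y,\hat z)\in X\times Y\times Z$ with $(\hat x,\hat y)\in\operatorname{gph}F$ and $(\hat y,\hat z)\in\operatorname{qri}(\operatorname{gph}G)$; (b) $G$ is polyhedral and there exists $(\hat x,\hat y,\hat z)\in X\times Y\times Z$ with $(\hat x,\hat y)\in\operatorname{qri}(\operatorname{gph}F)$ and $(\hat y,\hat z)\in\operatorname{gph}G$. Then for every $(\bar x,\bar z)\in\operatorname{gph}(G\circ F)$, every $z^*\in Z^*$ and every $\bar y\in F(\bar x)\cap G^{-1}(\bar z)$, $$D^*(G\circ F)(\bar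 x,\bar z)(z^*)=\bigl(D^*F(\bar x,\bar y)\circ D^*G(\bar y,\bar z)\bigr)(z^*).$$ -/

import Mathlib

namespace ConvexSetValued

/-- The conic hull `{t • a | t ≥ 0, a ∈ A}`. -/
def conicHull {X : Type*} [AddCommGroup X] [Module ℝ X] (A : Set X) : Set X :=
  {v | ∃ t : ℝ, 0 ≤ t ∧ ∃ a ∈ A, v = t • a}

/-- The quasi-relative interior of `Ω`: the points `x ∈ Ω` for which the closure of
`cone (Ω - x)` is a linear subspace. -/
def qri {X : Type*} [AddCommGroup X] [Module ℝ X] [TopologicalSpace X] (Ω : Set X) : Set X :=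
  {x | x ∈ Ω ∧ ∃ S : Submodule ℝ X, (S : Set X) = closure (conicHull ((fun w => w - x) '' Ω))}

/-- A polyhedral set (convex polyhedron): the solution set of finitely many inequalities
given by continuous linear functionals. -/
def IsPolyhedralSet {X : Type*} [AddCommGroup X] [Module ℝ X] [TopologicalSpace X]
    (P : Set X) : Prop :=
  ∃ (k : ℕ) (f : Fin k → StrongDual ℝ X) (α : Fin k → ℝ), P = {x | ∀ i, f i x ≤ α i}

/-- The normal cone to `Ω` at `x₀`, empty if `x₀ ∉ Ω`. -/
def normalCone {X : Type*} [AddCommGroup X] [Module ℝ X] [TopologicalSpace X]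
    (x₀ : X) (Ω : Set X) : Set (StrongDual ℝ X) :=
  {f | x₀ ∈ Ω ∧ ∀ x ∈ Ω, f (x - x₀) ≤ 0}

/-- The graph of a set-valued mapping. -/
def gph {X Y : Type*} (F : X → Set Y) : Set (X × Y) :=
  {p | p.2 ∈ F p.1}

/-- The composition `G ∘ F` of set-valued mappings. -/
def comp {X Y Z : Type*} (G : Y → Set Z) (F : X → Set Y) : X → Set Z :=
  fun x => ⋃ y ∈ F x, G y

/-- The inverse `G⁻¹` of a set-valued mapping. -/
def inv {Y Z : Type*} (G : Y → Set Z) : Z → Set Y :=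
  fun z => {y | z ∈ G y}

/-- A set-valued mapping is convex if its graph is convex. -/
def IsConvexMap {X Y : Type*} [AddCommGroup X] [Module ℝ X] [AddCommGroup Y] [Module ℝ Y]
    (F : X → Set Y) : Prop :=
  Convex ℝ (gph F)

/-- A set-valued mapping is polyhedral if its graph is a convex polyhedron. -/
def IsPolyhedralMap {X Y : Type*} [AddCommGroup X] [Module ℝ X] [TopologicalSpace X]
    [AddCommGroup Y] [Module ℝ Y] [TopologicalSpace Y] (F : X → Set Y) : Prop :=
  IsPolyhedralSet (gph F)

/-- The coderivative `D*F(x₀, y₀) : Y* ⇉ X*`,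
`y* ↦ {x* | (x*, -y*) ∈ N((x₀, y₀); gph F)}`, where the pair `(x*, -y*)` is the functional
`(x, y) ↦ x* x - y* y` on `X × Y`. -/
def coderivative {X Y : Type*} [AddCommGroup X] [Module ℝ X] [TopologicalSpace X]
    [AddCommGroup Y] [Module ℝ Y] [TopologicalSpace Y] [IsTopologicalAddGroup Y]
    (F : X → Set Y) (x₀ : X) (y₀ : Y) : StrongDual ℝ Y → Set (StrongDual ℝ X) :=
  fun ys => {xs | ContinuousLinearMap.coprod xs (-ys) ∈ normalCone (x₀, y₀) (gph F)}

end ConvexSetValued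

/-!
Put `W = X × Y × Z`, `Φ = gph F × Z` and `Γ = X × gph G`. A pair `(x*, -z*)` is normal to
`gph (G ∘ F)` at `(x₀, z₀)` exactly when `(x*, 0, -z*)` is normal to `Φ ∩ Γ` at `(x₀, y₀, z₀)`,
whichever intermediate point `y₀` is chosen. So the chain rule reduces to the intersection rule
`N(w₀; P ∩ Ω) ⊆ N(w₀; P) + N(w₀; Ω)` for a polyhedral `P` that meets `qri Ω`
(`exists_add_eq_of_mem_normalCone_inter`): functionals normal to `Φ` (to `Γ`) do not depend on `z`
(on `x`), by `exists_comp_eq_of_mem_normalCone_preimage`, and comparing coordinates yields `y*`.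

Of the quasi-relative interior only its dual property is used: at a point of `qri Ω` the normal
cone is symmetric (`neg_mem_normalCone_of_mem_qri`).

For the intersection rule, the constraints of `P` inactive at `w₀` can be dropped, since `Ω` is
convex. What remains is a Lagrange multiplier rule for finitely many homogeneous constraints
(`exists_multipliers`). Only finitely many functionals are involved, so weak separation in a
finite-dimensional space gives Fritz John multipliers (`exists_fritzJohn_multipliers`). If the
multiplier of the objective vanishes, symmetry of the normal cone forces the resulting combination
of the constraints to vanish on all of `Ω`; the inequalities that occur in it are then
equalities on `P ∩ Ω`, one of the constraints is redundant, and induction on the number of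
constraints applies. The multipliers of the new equalities may be negative, but adding a large
multiple of the vanishing combination corrects their signs.
-/

namespace ConvexSetValued

open Set

/-! ### Separation and multipliers -/

/-- Weak separation of the origin from a convex set in finite dimension: no interior is assumed,
because a set without interior lies in a proper subspace. -/
lemma exists_ne_zero_forall_le_zero {V : Type*} [NormedAddCommGroup V] [NormedSpace ℝ V]
    [FiniteDimensional ℝ V] {C : Set V} (hC : Convex ℝ C) (h0 : (0 : V) ∈ C)
    (hint : (0 : V) ∉ interior C) :
    ∃ φ : V →ₗ[ℝ] ℝ, φ ≠ 0 ∧ ∀ c ∈ C, φ c ≤ 0 := by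
  by_cases hne : (interior C).Nonempty
  · obtain ⟨φ, hφ⟩ := geometric_hahn_banach_open_point hC.interior isOpen_interior hint
    simp only [map_zero] at hφ
    refine ⟨φ, ?_, fun c hc => ?_⟩
    · rintro h
      obtain ⟨c, hc⟩ := hne
      have := hφ c hc
      have h' : φ c = 0 := LinearMap.congr_fun h c
      linarith
    · have hcl : c ∈ closure (interior C) := by
        rw [hC.closure_interior_eq_closure_of_nonempty_interior hne]
        exact subset_closure hc
      exact closure_minimal (fun x hx => (hφ x hx).le)
        (isClosed_le φ.continuous continuous_const) hcl
  · have hspan : Submodule.span ℝ C < ⊤ := by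
      refine lt_top_iff_ne_top.2 fun h => hne ?_
      rw [hC.interior_nonempty_iff_affineSpan_eq_top,
        AffineSubspace.affineSpan_eq_top_iff_vectorSpan_eq_top_of_nonempty ℝ V V ⟨0, h0⟩,
        vectorSpan_eq_span_vsub_set_right ℝ h0]
      simpa using h
    obtain ⟨φ, hφ, hle⟩ := Submodule.exists_le_ker_of_lt_top _ hspan
    exact ⟨φ, hφ, fun c hc => (LinearMap.mem_ker.1 (hle (Submodule.subset_span hc))).le⟩

/-- Fritz John multipliers: the constraints are `p i ≤ 0` for all `i ∈ s`, with equality required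
when `i ∉ I`. The multiplier `τ` of the objective may vanish. -/
lemma exists_fritzJohn_multipliers {W ι : Type*} [AddCommGroup W] [Module ℝ W]
    {Ω : Set W} (hΩ : Convex ℝ Ω) (h0 : (0 : W) ∈ Ω) (f : W →ₗ[ℝ] ℝ) (p : ι → W →ₗ[ℝ] ℝ)
    (s : Finset ι) (I : Set ι)
    (hf : ∀ w ∈ Ω, (∀ i ∈ s, p i w ≤ 0) → (∀ i ∈ s, i ∉ I → p i w = 0) → f w ≤ 0) :
    ∃ (μ : ι → ℝ) (τ : ℝ), 0 ≤ τ ∧ (∀ i ∈ s, i ∈ I → 0 ≤ μ i) ∧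
      (τ = 0 → ∃ i ∈ s, μ i ≠ 0) ∧ ∀ w ∈ Ω, τ * f w ≤ ∑ i ∈ s, μ i * p i w := by
  classical
  -- The values of constraints and objective on `Ω`, relaxed in the directions in which slack
  -- is allowed.
  let C : Set ((s → ℝ) × ℝ) :=
    {c | ∃ w ∈ Ω, (∀ i : s, p i w ≤ c.1 i) ∧ (∀ i : s, (i : ι) ∉ I → c.1 i = p i w) ∧
      c.2 ≤ f w}
  have hC : Convex ℝ C := by
    rintro c ⟨w, hw, h1, h2, h3⟩ d ⟨v, hv, k1, k2, k3⟩ a b ha hb hab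
    refine ⟨a • w + b • v, hΩ hw hv ha hb hab, fun i => ?_, fun i hi => ?_, ?_⟩
    · simp only [map_add, map_smul, smul_eq_mul, Prod.fst_add, Prod.smul_fst, Pi.add_apply,
        Pi.smul_apply]
      exact add_le_add (mul_le_mul_of_nonneg_left (h1 i) ha) (mul_le_mul_of_nonneg_left (k1 i) hb)
    · simp [h2 i hi, k2 i hi]
    · simp only [map_add, map_smul, smul_eq_mul, Prod.snd_add, Prod.smul_snd]
      exact add_le_add (mul_le_mul_of_nonneg_left h3 ha) (mul_le_mul_of_nonneg_left k3 hb)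
  have hC0 : (0 : (s → ℝ) × ℝ) ∈ C := ⟨0, h0, by simp, by simp, by simp⟩
  have hint : (0 : (s → ℝ) × ℝ) ∉ interior C := by
    intro h
    -- If `0` were interior to `C`, some `(0, t)` with `t > 0` would lie in `C`.
    have hcont : Filter.Tendsto (fun t : ℝ => ((0 : s → ℝ), t)) (nhds 0)
        (nhds (0 : (s → ℝ) × ℝ)) :=
      (Continuous.prodMk_right (0 : s → ℝ)).tendsto 0
    have hev := hcont (mem_interior_iff_mem_nhds.1 h)
    obtain ⟨ε, hε, hball⟩ := Metric.mem_nhds_iff.1 hev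
    obtain ⟨w, hw, h1, h2, h3⟩ : ((0 : s → ℝ), ε / 2) ∈ C := by
      refine hball ?_
      rw [Metric.mem_ball, Real.dist_eq, sub_zero, abs_of_pos (half_pos hε)]
      linarith
    have := hf w hw (fun i hi => h1 ⟨i, hi⟩) (fun i hi hI => (h2 ⟨i, hi⟩ hI).symm)
    simp only at h3
    linarith
  obtain ⟨φ, hφ, hle⟩ := exists_ne_zero_forall_le_zero hC hC0 hint
  let ν : s → ℝ := fun i => -φ (Pi.single i 1, 0)
  have hφeq : ∀ u t, φ (u, t) = -(∑ i, ν i * u i) + φ (0, 1) * t := by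
    intro u t
    have h1 : (u, t) = (u, (0 : ℝ)) + t • ((0 : s → ℝ), (1 : ℝ)) := by simp
    have h2 : (u, (0 : ℝ)) = ∑ i, u i • ((Pi.single i 1 : s → ℝ), (0 : ℝ)) := by
      refine Prod.ext ?_ ?_
      · simp only [Prod.fst_sum, Prod.smul_fst]
        exact pi_eq_sum_univ' u
      · simp [Prod.snd_sum]
    rw [h1, map_add, h2, map_smul, smul_eq_mul, mul_comm t]
    simp only [map_sum, map_smul, smul_eq_mul]
    simp only [ν, mul_comm, mul_neg, Finset.sum_neg_distrib, neg_neg]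
  refine ⟨fun i => if hi : i ∈ s then ν ⟨i, hi⟩ else 0, φ (0, 1), ?_, ?_, ?_, ?_⟩
  · have := hle (0, -1) ⟨0, h0, by simp, by simp, by simp⟩
    rw [hφeq] at this
    simpa using this
  · intro i hi hI
    have := hle (Pi.single ⟨i, hi⟩ 1, 0) ⟨0, h0, fun j => ?_, fun j hj => ?_, by simp⟩
    · simpa [hi, ν] using this
    · rw [map_zero]
      exact (Pi.single_nonneg (i := (⟨i, hi⟩ : s)).2 zero_le_one : (0 : s → ℝ) ≤ _) j
    · rw [map_zero]
      exact Pi.single_eq_of_ne (fun h => hj (by rw [h]; exact hI)) _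
  · intro hτ
    by_contra! hν
    refine hφ (LinearMap.ext fun c => ?_)
    have : ∀ i : s, ν i = 0 := fun i => by simpa using hν i i.2
    rw [← Prod.mk.eta (p := c), hφeq]
    simp [this, hτ]
  · intro w hw
    have := hle (fun i => p i w, f w) ⟨w, hw, by simp, by simp, le_rfl⟩
    rw [hφeq] at this
    rw [← Finset.sum_coe_sort s]
    simp only [Finset.coe_mem, dite_true, Subtype.coe_eta]
    linarith

/-- Lagrange multipliers for finitely many homogeneous linear constraints `p i ≤ 0`, `i ∈ s`, with
equality required when `i ∉ I`. The qualification condition is a feasible `v ∈ Ω` such that every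
functional supporting `Ω` at both `0` and `v` vanishes on `Ω`. -/
lemma exists_multipliers {W ι : Type*} [AddCommGroup W] [Module ℝ W] [TopologicalSpace W]
    {Ω : Set W} (hΩ : Convex ℝ Ω) (h0 : (0 : W) ∈ Ω) (f : StrongDual ℝ W)
    (p : ι → StrongDual ℝ W) {v : W} (hv : v ∈ Ω)
    (hqual : ∀ g : StrongDual ℝ W, (∀ w ∈ Ω, 0 ≤ g w) → g v = 0 → ∀ w ∈ Ω, g w = 0)
    (s : Finset ι) (I : Set ι)
    (hvs : ∀ i ∈ s, p i v ≤ 0) (hvI : ∀ i ∈ s, i ∉ I → p i v = 0)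
    (hf : ∀ w ∈ Ω, (∀ i ∈ s, p i w ≤ 0) → (∀ i ∈ s, i ∉ I → p i w = 0) → f w ≤ 0) :
    ∃ μ : ι → ℝ, (∀ i ∈ s, i ∈ I → 0 ≤ μ i) ∧ ∀ w ∈ Ω, f w ≤ ∑ i ∈ s, μ i * p i w := by
  classical
  induction s using Finset.strongInduction generalizing I with
  | H s ih =>
  obtain ⟨μ, τ, hτ, hμ, hne, hle⟩ := exists_fritzJohn_multipliers hΩ h0 f.toLinearMap
    (fun i => (p i).toLinearMap) s I hf
  simp only [ContinuousLinearMap.coe_coe] at hle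
  rcases hτ.lt_or_eq with hτ | hτ
  · refine ⟨fun i => μ i / τ, fun i hi hI => div_nonneg (hμ i hi hI) hτ.le, fun w hw => ?_⟩
    have := hle w hw
    have h2 : ∑ i ∈ s, μ i / τ * p i w = (∑ i ∈ s, μ i * p i w) / τ := by
      rw [Finset.sum_div]
      exact Finset.sum_congr rfl fun i _ => by ring
    rw [h2, le_div_iff₀ hτ, mul_comm]
    exact this
  · obtain ⟨j, hj, hμj⟩ := hne hτ.symm
    have hnonneg : ∀ w ∈ Ω, 0 ≤ ∑ i ∈ s, μ i * p i w := fun w hw => by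
      have := hle w hw
      rwa [← hτ, zero_mul] at this
    have hterm : ∀ i ∈ s, μ i * p i v ≤ 0 := fun i hi => by
      by_cases hI : i ∈ I
      · exact mul_nonpos_of_nonneg_of_nonpos (hμ i hi hI) (hvs i hi)
      · rw [hvI i hi hI, mul_zero]
    have hsumv : ∑ i ∈ s, μ i * p i v = 0 :=
      le_antisymm (Finset.sum_nonpos hterm) (hnonneg v hv)
    have hzero : ∀ w ∈ Ω, ∑ i ∈ s, μ i * p i w = 0 := by
      have := hqual (∑ i ∈ s, μ i • p i)
      simp only [FunLike.coe_sum, Finset.sum_apply, FunLike.coe_smul,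
        Pi.smul_apply, smul_eq_mul] at this
      exact this hnonneg hsumv
    -- Inequalities with a nonzero multiplier become equalities, and the constraint `j` is dropped.
    have hvz : ∀ i ∈ s, μ i ≠ 0 → p i v = 0 := fun i hi hμi =>
      (mul_eq_zero.1 ((Finset.sum_eq_zero_iff_of_nonpos hterm).1 hsumv i hi)).resolve_left hμi
    obtain ⟨ξ, hξ, hξle⟩ := ih (s.erase j) (Finset.erase_ssubset hj) (I ∩ {i | μ i = 0})
      (fun i hi => hvs i (Finset.mem_of_mem_erase hi))
      (fun i hi hI => by
        have hi' := Finset.mem_of_mem_erase hi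
        by_cases h : μ i = 0
        · exact hvI i hi' fun h' => hI ⟨h', h⟩
        · exact hvz i hi' h)
      (fun w hw h1 h2 => by
        have hpj : p j w = 0 := by
          have hz := hzero w hw
          rw [← Finset.add_sum_erase s _ hj, Finset.sum_eq_zero, add_zero] at hz
          · exact (mul_eq_zero.1 hz).resolve_left hμj
          · intro i hi
            by_cases h : μ i = 0
            · rw [h, zero_mul]
            · rw [h2 i hi fun h' => h h'.2, mul_zero]
        refine hf w hw (fun i hi => ?_) (fun i hi hI => ?_)
        · by_cases h : i = j
          · rw [h, hpj]
          · exact h1 i (Finset.mem_erase.2 ⟨h, hi⟩)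
        · by_cases h : i = j
          · rw [h, hpj]
          · exact h2 i (Finset.mem_erase.2 ⟨h, hi⟩) fun h' => hI h'.1)
    let η : ι → ℝ := fun i => if i = j then 0 else ξ i
    have hη : ∀ w, ∑ i ∈ s, η i * p i w = ∑ i ∈ s.erase j, ξ i * p i w := fun w => by
      rw [← Finset.add_sum_erase s _ hj]
      simp only [η, if_true, zero_mul, zero_add]
      exact Finset.sum_congr rfl fun i hi => by rw [if_neg (Finset.ne_of_mem_erase hi)]
    -- `M` is so large that `η i + M * μ i ≥ 0` whenever `μ i > 0`.
    let M : ℝ := ∑ i ∈ s, |η i| / |μ i|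
    refine ⟨fun i => η i + M * μ i, fun i hi hI => ?_, fun w hw => ?_⟩
    · rcases (hμ i hi hI).lt_or_eq with hpos | hz
      · have h1 : |η i| / |μ i| ≤ M :=
          Finset.single_le_sum (f := fun i => |η i| / |μ i|) (fun i _ => by positivity) hi
        rw [abs_of_pos hpos, div_le_iff₀ hpos] at h1
        have := neg_abs_le (η i)
        linarith
      · have hij : i ≠ j := fun h => hμj (h ▸ hz.symm)
        beta_reduce
        rw [← hz, mul_zero, add_zero]
        simp only [η, if_neg hij]
        exact hξ i (Finset.mem_erase.2 ⟨hij, hi⟩) ⟨hI, hz.symm⟩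
    · have h1 : ∑ i ∈ s, (η i + M * μ i) * p i w
          = ∑ i ∈ s, η i * p i w + M * ∑ i ∈ s, μ i * p i w := by
        rw [Finset.mul_sum, ← Finset.sum_add_distrib]
        exact Finset.sum_congr rfl fun i _ => by ring
      rw [h1, hzero w hw, hη]
      simpa using hξle w hw

/-! ### Normal cones -/

/-- A functional normal to `Ω` at a point of `qri Ω` is nonpositive on the subspace
`closure (cone (Ω - x))`, hence zero there. -/
lemma neg_mem_normalCone_of_mem_qri {W : Type*} [AddCommGroup W] [Module ℝ W]
    [TopologicalSpace W] {Ω : Set W} {x : W} (hx : x ∈ qri Ω) {g : StrongDual ℝ W}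
    (hg : g ∈ normalCone x Ω) : -g ∈ normalCone x Ω := by
  obtain ⟨hxΩ, S, hS⟩ := hx
  have hle : ∀ u ∈ S, g u ≤ 0 := fun u hu => by
    have hu' : u ∈ closure (conicHull ((fun w => w - x) '' Ω)) := hS ▸ hu
    refine closure_minimal ?_ (isClosed_le g.continuous continuous_const) hu'
    rintro _ ⟨t, ht, _, ⟨w, hw, rfl⟩, rfl⟩
    simp only [mem_ofPred_eq, map_smul, smul_eq_mul]
    exact mul_nonpos_of_nonneg_of_nonpos ht (hg.2 w hw)
  refine ⟨hxΩ, fun w hw => ?_⟩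
  have hwS : w - x ∈ S := by
    rw [← SetLike.mem_coe, hS]
    exact subset_closure ⟨1, zero_le_one, _, ⟨w, hw, rfl⟩, (one_smul ℝ _).symm⟩
  have := hle _ (S.neg_mem hwS)
  rwa [map_neg] at this

/-- A functional normal to the preimage of `Ω` under a split surjection `A` vanishes on `ker A`,
so it factors through `A`. -/
lemma exists_comp_eq_of_mem_normalCone_preimage {W U : Type*}
    [AddCommGroup W] [Module ℝ W] [TopologicalSpace W]
    [AddCommGroup U] [Module ℝ U] [TopologicalSpace U]
    {A : W →L[ℝ] U} {B : U →L[ℝ] W} (hAB : ∀ u, A (B u) = u) {Ω : Set U} {w₀ : W}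
    {g : StrongDual ℝ W} (hg : g ∈ normalCone w₀ (A ⁻¹' Ω)) :
    ∃ h ∈ normalCone (A w₀) Ω, g = h.comp A := by
  obtain ⟨hw₀, hle⟩ := hg
  have hker : ∀ k, A k = 0 → g k ≤ 0 := fun k hk => by
    simpa using hle (w₀ + k) (by simpa [hk] using hw₀)
  have hker' : ∀ k, A k = 0 → g k = 0 := fun k hk =>
    le_antisymm (hker k hk) (by simpa using hker (-k) (by simp [hk]))
  have hgBA : ∀ w, g w = g (B (A w)) := fun w => by
    have := hker' (w - B (A w)) (by simp [hAB])
    rwa [map_sub, sub_eq_zero] at this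
  refine ⟨g.comp B, ⟨hw₀, fun u hu => ?_⟩, ContinuousLinearMap.ext hgBA⟩
  have := hle (B u) (by simpa [hAB] using hu)
  rw [map_sub] at this
  simpa [← hgBA] using this

lemma neg_mem_normalCone_preimage_of_mem_qri {W U : Type*}
    [AddCommGroup W] [Module ℝ W] [TopologicalSpace W]
    [AddCommGroup U] [Module ℝ U] [TopologicalSpace U]
    {A : W →L[ℝ] U} {B : U →L[ℝ] W} (hAB : ∀ u, A (B u) = u) {Ω : Set U} {v : W}
    (hv : A v ∈ qri Ω) {g : StrongDual ℝ W} (hg : g ∈ normalCone v (A ⁻¹' Ω)) :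
    -g ∈ normalCone v (A ⁻¹' Ω) := by
  obtain ⟨h, hh, rfl⟩ := exists_comp_eq_of_mem_normalCone_preimage hAB hg
  have hneg := (neg_mem_normalCone_of_mem_qri hv hh).2
  exact ⟨hg.1, fun w hw => by simpa using hneg (A w) hw⟩

lemma IsPolyhedralSet.preimage {W U : Type*}
    [AddCommGroup W] [Module ℝ W] [TopologicalSpace W]
    [AddCommGroup U] [Module ℝ U] [TopologicalSpace U]
    {P : Set U} (hP : IsPolyhedralSet P) (A : W →L[ℝ] U) : IsPolyhedralSet (A ⁻¹' P) := by
  obtain ⟨k, f, α, rfl⟩ := hP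
  exact ⟨k, fun i => (f i).comp A, α, rfl⟩

/-- The normal cone intersection rule for a polyhedral set `P` and a convex set `Ω`. The
qualification condition is a point of `P ∩ Ω` at which the normal cone to `Ω` is symmetric. -/
lemma exists_add_eq_of_mem_normalCone_inter {W : Type*} [AddCommGroup W] [Module ℝ W]
    [TopologicalSpace W] {P Ω : Set W} (hP : IsPolyhedralSet P) (hΩ : Convex ℝ Ω) {v : W}
    (hvP : v ∈ P) (hvΩ : v ∈ Ω) (hv : ∀ g ∈ normalCone v Ω, -g ∈ normalCone v Ω)
    {w₀ : W} {f : StrongDual ℝ W} (hf : f ∈ normalCone w₀ (P ∩ Ω)) :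
    ∃ g ∈ normalCone w₀ P, ∃ h ∈ normalCone w₀ Ω, f = g + h := by
  classical
  obtain ⟨k, p, α, rfl⟩ := hP
  obtain ⟨⟨hwP, hwΩ⟩, hfle⟩ := hf
  simp only [mem_ofPred_eq] at hwP hvP
  -- The constraints active at `w₀`.
  let s : Finset (Fin k) := Finset.univ.filter fun i => p i w₀ = α i
  have hs : ∀ i, i ∈ s ↔ p i w₀ = α i := fun i => by simp [s]
  obtain ⟨μ, hμ, hμle⟩ := exists_multipliers (Ω := {u | w₀ + u ∈ Ω}) (v := v - w₀)
    (hΩ.translate_preimage_right w₀) (by simpa using hwΩ) f p (by simpa using hvΩ)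
    (fun g hg hgv w hw => by
      have hgN : -g ∈ normalCone v Ω := ⟨hvΩ, fun x hx => by
        have := hg (x - w₀) (by simpa using hx)
        rw [map_sub] at this hgv
        simp only [neg_apply, map_sub]
        linarith⟩
      have h1 := (hv _ hgN).2 (w₀ + w) hw
      have h2 := hg w hw
      simp only [neg_neg, map_sub, map_add] at h1 hgv
      linarith)
    s univ
    (fun i hi => by
      have := hvP i
      rw [map_sub, (hs i).1 hi]
      linarith)
    (fun i _ h => absurd (mem_univ i) h)
    (fun u hu hus _ => by
      -- A short step along `u` stays in `P`: the inactive constraints have slack.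
      have hev : ∀ i, ∀ᶠ t : ℝ in nhdsWithin 0 (Ioi 0), p i (w₀ + t • u) ≤ α i := fun i => by
        by_cases hi : i ∈ s
        · filter_upwards [self_mem_nhdsWithin] with t ht
          rw [map_add, map_smul, (hs i).1 hi, smul_eq_mul]
          have := mul_nonpos_of_nonneg_of_nonpos (le_of_lt ht) (hus i hi)
          linarith
        · have hlt : p i w₀ < α i := lt_of_le_of_ne (hwP i) fun h => hi ((hs i).2 h)
          have hc : Continuous fun t : ℝ => p i w₀ + t * p i u := by fun_prop
          have : ∀ᶠ t : ℝ in nhds 0, p i w₀ + t * p i u < α i :=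
            hc.continuousAt.eventually_lt continuousAt_const (by simpa using hlt)
          filter_upwards [nhdsWithin_le_nhds this] with t ht
          rw [map_add, map_smul, smul_eq_mul]
          exact ht.le
      obtain ⟨t, ht, ht0, ht1⟩ := ((Filter.eventually_all.2 hev).and
        (Ioo_mem_nhdsGT (zero_lt_one (α := ℝ)))).exists
      have hmem : w₀ + t • u ∈ Ω := by
        have := hΩ.add_smul_mem hwΩ hu (t := t) ⟨ht0.le, ht1.le⟩
        exact this
      have := hfle (w₀ + t • u) ⟨ht, hmem⟩
      rw [add_sub_cancel_left, map_smul, smul_eq_mul] at this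
      exact nonpos_of_mul_nonpos_right this ht0)
  have happ : ∀ w, (∑ i ∈ s, μ i • p i) w = ∑ i ∈ s, μ i * p i w := fun w => by simp
  refine ⟨∑ i ∈ s, μ i • p i, ⟨hwP, fun x hx => ?_⟩, f - ∑ i ∈ s, μ i • p i,
    ⟨hwΩ, fun x hx => ?_⟩, by simp⟩
  · rw [happ]
    refine Finset.sum_nonpos fun i hi =>
      mul_nonpos_of_nonneg_of_nonpos (hμ i hi (mem_univ i)) ?_
    have := hx i
    rw [map_sub, (hs i).1 hi]
    linarith
  · have := hμle (x - w₀) (by simpa using hx)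
    rw [sub_apply, happ]
    linarith

end ConvexSetValued

/-! ### The coderivative chain rule -/

open ConvexSetValued in
theorem theorem5p7
    {X Y Z : Type*}
    [AddCommGroup X] [Module ℝ X] [TopologicalSpace X] [IsTopologicalAddGroup X]
    [ContinuousSMul ℝ X] [LocallyConvexSpace ℝ X]
    [AddCommGroup Y] [Module ℝ Y] [TopologicalSpace Y] [IsTopologicalAddGroup Y]
    [ContinuousSMul ℝ Y] [LocallyConvexSpace ℝ Y]
    [AddCommGroup Z] [Module ℝ Z] [TopologicalSpace Z] [IsTopologicalAddGroup Z]
    [ContinuousSMul ℝ Z] [LocallyConvexSpace ℝ Z]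
    (F : X → Set Y) (G : Y → Set Z)
    (hF : ConvexSetValued.IsConvexMap F) (hG : ConvexSetValued.IsConvexMap G)
    (hqc :
      (ConvexSetValued.IsPolyhedralMap F ∧ ∃ (x : X) (y : Y) (z : Z),
        (x, y) ∈ ConvexSetValued.gph F ∧
          (y, z) ∈ ConvexSetValued.qri (ConvexSetValued.gph G)) ∨
      (ConvexSetValued.IsPolyhedralMap G ∧ ∃ (x : X) (y : Y) (z : Z),
        (x, y) ∈ ConvexSetValued.qri (ConvexSetValued.gph F) ∧
          (y, z) ∈ ConvexSetValued.gph G))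
    (x₀ : X) (z₀ : Z) (hxz : (x₀, z₀) ∈ ConvexSetValued.gph (ConvexSetValued.comp G F))
    (zs : StrongDual ℝ Z) (y₀ : Y) (hy : y₀ ∈ F x₀ ∩ ConvexSetValued.inv G z₀) :
    ConvexSetValued.coderivative (ConvexSetValued.comp G F) x₀ z₀ zs =
      ConvexSetValued.comp (ConvexSetValued.coderivative F x₀ y₀)
        (ConvexSetValued.coderivative G y₀ z₀) zs := by
  obtain ⟨hyF, hyG⟩ := hy
  ext xs
  simp only [ConvexSetValued.comp, Set.mem_iUnion, exists_prop]
  constructor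
  · rintro ⟨-, hle⟩
    let A : X × Y × Z →L[ℝ] X × Y :=
      (ContinuousLinearMap.fst ℝ X (Y × Z)).prod
        ((ContinuousLinearMap.fst ℝ Y Z).comp (ContinuousLinearMap.snd ℝ X (Y × Z)))
    let A' : X × Y →L[ℝ] X × Y × Z :=
      (ContinuousLinearMap.fst ℝ X Y).prod
        ((ContinuousLinearMap.inl ℝ Y Z).comp (ContinuousLinearMap.snd ℝ X Y))
    have hA : ∀ u, A (A' u) = u := fun u => rfl
    let B : X × Y × Z →L[ℝ] Y × Z := ContinuousLinearMap.snd ℝ X (Y × Z)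
    have hB : ∀ u, B (ContinuousLinearMap.inr ℝ X (Y × Z) u) = u := fun u => rfl
    let f : StrongDual ℝ (X × Y × Z) :=
      xs.coprod ((-zs).comp (ContinuousLinearMap.snd ℝ Y Z))
    have hf : ∀ w ∈ A ⁻¹' gph F ∩ B ⁻¹' gph G, f (w - (x₀, y₀, z₀)) ≤ 0 := by
      rintro ⟨x, y, z⟩ ⟨h1, h2⟩
      exact hle (x, z) (Set.mem_biUnion h1 h2)
    have hsplit : ∃ g ∈ normalCone (x₀, y₀, z₀) (A ⁻¹' gph F),
        ∃ h ∈ normalCone (x₀, y₀, z₀) (B ⁻¹' gph G), f = g + h := by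
      rcases hqc with ⟨hpoly, x, y, z, h1, h2⟩ | ⟨hpoly, x, y, z, h1, h2⟩
      · exact exists_add_eq_of_mem_normalCone_inter (v := (x, y, z))
          (IsPolyhedralSet.preimage hpoly A) (hG.linear_preimage B.toLinearMap) h1 h2.1
          (fun g hg => neg_mem_normalCone_preimage_of_mem_qri hB h2 hg) ⟨⟨hyF, hyG⟩, hf⟩
      · obtain ⟨g, hg, h, hh, heq⟩ := exists_add_eq_of_mem_normalCone_inter (v := (x, y, z))
          (f := f) (w₀ := (x₀, y₀, z₀))
          (IsPolyhedralSet.preimage hpoly B) (hF.linear_preimage A.toLinearMap) h2 h1.1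
          (fun g hg => neg_mem_normalCone_preimage_of_mem_qri hA h1 hg)
          ⟨⟨hyG, hyF⟩, fun w hw => hf w hw.symm⟩
        exact ⟨h, hh, g, hg, heq.trans (add_comm g h)⟩
    obtain ⟨g, hg, h, hh, heq⟩ := hsplit
    obtain ⟨g, hg', rfl⟩ := exists_comp_eq_of_mem_normalCone_preimage hA hg
    obtain ⟨h, hh', rfl⟩ := exists_comp_eq_of_mem_normalCone_preimage hB hh
    -- The coordinates of `(x*, 0, -z*) = (g, 0) + (0, h)`.
    have hx : ∀ x, xs x = g (x, 0) := fun x => by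
      have : f (x, 0, 0) = g (x, 0) + h (0, 0) := DFunLike.congr_fun heq (x, 0, 0)
      rw [Prod.mk_zero_zero, map_zero, add_zero] at this
      simpa [f] using this
    have hz : ∀ z, -zs z = h (0, z) := fun z => by
      have : f (0, 0, z) = g (0, 0) + h (0, z) := DFunLike.congr_fun heq (0, 0, z)
      rw [Prod.mk_zero_zero, map_zero, zero_add] at this
      simpa [f] using this
    have hy : ∀ y, g (0, y) = -h (y, 0) := fun y => by
      have : f (0, y, 0) = g (0, y) + h (y, 0) := DFunLike.congr_fun heq (0, y, 0)
      have h0 : f (0, y, 0) = 0 := by simp [f]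
      linarith
    let ys : StrongDual ℝ Y := h.comp (ContinuousLinearMap.inl ℝ Y Z)
    have hgeq : ContinuousLinearMap.coprod xs (-ys) = g := by
      ext u
      · simp [hx]
      · simp [hy, ys]
    have hheq : ContinuousLinearMap.coprod ys (-zs) = h := by
      ext u
      · simp [ys]
      · simp [hz]
    refine ⟨ys, ?_, ?_⟩
    · change ContinuousLinearMap.coprod ys (-zs) ∈ normalCone (y₀, z₀) (gph G)
      rw [hheq]
      exact hh'
    · change ContinuousLinearMap.coprod xs (-ys) ∈ normalCone (x₀, y₀) (gph F)
      rw [hgeq]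
      exact hg'
  · rintro ⟨ys, ⟨-, hG'⟩, ⟨-, hF'⟩⟩
    refine ⟨hxz, ?_⟩
    rintro ⟨x, z⟩ hmem
    obtain ⟨y, hy1, hy2⟩ := Set.mem_iUnion₂.1 hmem
    have h1 := hF' (x, y) hy1
    have h2 := hG' (y, z) hy2
    simp only [Prod.mk_sub_mk, ContinuousLinearMap.coprod_apply, neg_apply] at h1 h2 ⊢
    linarith
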